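/- Setting. A storage network has $n$ nodes; a failed node is replaced by a newcomer that receives an amount $\beta$ of data from each of $d$ helpers chosen among the $n-1$ surviving nodes, and each node stores an amount $\alpha$. A dynamic helper selection (DHS) scheme $A$ is a family of functions that, at each repair time $\tau$, choose the $d$-element helper set of the newcomer as a function of the sequence $F_1,\dots,F_\tau$ of the nodes that have failed so far. Every finite failure sequence, together with the helper sets chosen by $A$, gives an information flow graph $G$: a source $s$ is joined by edges of infinite capacity to the input vertices of the $n$ initial storage nodes; each storage node (initial node or newcomer) has an edge of capacity $\alpha$ from its input vertex to its output vertex; each newcomer's input vertex receives an edge of capacity $\beta$ from the output vertex of each of its $d$ helpers, which are active at that time; and for each set of $k$ of the $n$ currently active nodes there is a data collector $t$, joined by edges of infinite capacity from their output vertices. Let $\mathcal G_A$ be the collection of all these graphs, $\mathrm{DC}(G)$ the set of data collectors of $G$, and call $\min_{G\in\mathcal G_A}\min_{t\in \mathrm{DC}(G)}\mathrm{mincut}_G(s,t)$ the min-cut of $A$. The family helper selection (FHS) scheme $F$: sort the nodes arbitrarily as $1,\dots,n$ and divide them into $\lfloor n/(n-d)\rfloor$ consecutive complete families of $n-d$ nodes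 each, the remaining $n \bmod (n-d)$ nodes forming an incomplete family; a failed node of a complete family is always helped by the $d$ nodes outside its family, and a failed node of the incomplete family by the nodes $1,\dots,d$. Proposition. Let $d\ge 2$ be even, $n=d+2$ and $k=\frac n2+1$. Then, for every sorting of the nodes, FHS is absolutely optimal: for every DHS scheme $A$ and all $\alpha,\beta\in[0,\infty]$, $$\min_{G\in \mathcal G_F}\min_{t\in \mathrm{DC}(G)}\mathrm{mincut}_G(s,t)\ \ge\ \min_{G\in \mathcal G_A}\min_{t\in \mathrm{DC}(G)}\mathrm{mincut}_G(s,t).$$ Moreover, for all $\alpha,\beta\in[0,\infty]$ (with $0\cdot\infty=0$), the left-hand side equals $$\sum_{i=2}^{k-1}\min\big((d-i)\beta,\alpha\big)+2\min(d\beta,\alpha).$$ -/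

import Mathlib

open scoped ENNReal

namespace RegeneratingCode

/-- The minimum value of a cut `(U, Uᶜ)` with `s ∈ U` and `t ∉ U` in a finite directed network on
the vertex set `V`, where `c u v` is the capacity of the edge from `u` to `v`
(`0` when there is no such edge, `∞` when the capacity is unlimited). -/
noncomputable def minCut {V : Type*} [Fintype V] [DecidableEq V]
    (c : V → V → ℝ≥0∞) (s t : V) : ℝ≥0∞ :=
  ⨅ (U : Finset V) (_ : s ∈ U) (_ : t ∉ U), ∑ u ∈ U, ∑ v ∈ Uᶜ, c u v

/-- A dynamic helper selection scheme: for each time slot `τ = 0, 1, 2, …`, a function of the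
physical nodes that have failed in the slots `0, …, τ` (the last one being the node that has just
failed), which returns the set of `d` helpers, chosen among the `n - 1` surviving nodes. -/
structure DHS (n d : ℕ) where
  helpers : (τ : ℕ) → (Fin (τ + 1) → Fin n) → Finset (Fin n)
  card_helpers : ∀ τ F, (helpers τ F).card = d
  failed_notMem : ∀ τ F, F (Fin.last τ) ∉ helpers τ F

/-- A stationary helper selection scheme: one fixed set of `d` helpers for each node. -/
structure SHS (n d : ℕ) where
  helpers : Fin n → Finset (Fin n)
  card_helpers : ∀ i, (helpers i).card = d
  failed_notMem : ∀ i, i ∉ helpers i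

/-- A stationary scheme, seen as a dynamic one. -/
def SHS.toDHS {n d : ℕ} (A : SHS n d) : DHS n d where
  helpers τ F := A.helpers (F (Fin.last τ))
  card_helpers _ _ := A.card_helpers _
  failed_notMem _ _ := A.failed_notMem _

/-- The data that determine an information flow graph: the number `T` of repairs made so far, and,
for each of them, the physical node that failed and the `d` surviving nodes that helped. -/
structure IFG (n d : ℕ) where
  T : ℕ
  failed : Fin T → Fin n
  helpers : Fin T → Finset (Fin n)
  card_helpers : ∀ τ, (helpers τ).card = d
  failed_notMem : ∀ τ, failed τ ∉ helpers τ

/-- The storage nodes of an information flow graph: `Sum.inl i` is the initial node with the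
physical index `i`, and `Sum.inr τ` is the newcomer of the `τ`-th repair. -/
abbrev StorageNode (n T : ℕ) : Type := Fin n ⊕ Fin T

/-- The vertices of an information flow graph: the source, the input and output vertex of each
storage node, and one data collector for each choice of `k` of the `n` active nodes. -/
inductive Vertex (n k T : ℕ) : Type
  | source : Vertex n k T
  | inp : StorageNode n T → Vertex n k T
  | out : StorageNode n T → Vertex n k T
  | dc : {S : Finset (Fin n) // S.card = k} → Vertex n k T
  deriving DecidableEq, Fintype

namespace IFG

variable {n d : ℕ}

/-- `G.active m i` is the storage node that plays the role of the physical node `i` after the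
first `m` repairs. -/
def active (G : IFG n d) : ℕ → Fin n → StorageNode n G.T
  | 0, i => Sum.inl i
  | m + 1, i =>
    if h : m < G.T then
      if G.failed ⟨m, h⟩ = i then Sum.inr ⟨m, h⟩ else G.active m i
    else G.active m i

/-- The edge capacities of the information flow graph with the storage size `α` per node and the
repair traffic `β` per helper. The source feeds the initial nodes through edges of infinite
capacity; each storage node has an edge of capacity `α` from its input to its output; each newcomer
has an edge of capacity `β` from the output of each of its `d` helpers, active at the time of the
repair; each data collector has edges of infinite capacity from its `k` active nodes. -/
noncomputable def capacity (G : IFG n d) (k : ℕ) (α β : ℝ≥0∞) :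
    Vertex n k G.T → Vertex n k G.T → ℝ≥0∞
  | .source, .inp (Sum.inl _) => ∞
  | .inp x, .out y => if x = y then α else 0
  | .out x, .inp (Sum.inr τ) => if ∃ i ∈ G.helpers τ, G.active τ i = x then β else 0
  | .out x, .dc S => if ∃ i ∈ S.1, G.active G.T i = x then ∞ else 0
  | _, _ => 0

/-- `G` is one of the information flow graphs that the scheme `A` generates: every helper set in
`G` is the one that `A` selects, given the failures up to that time. -/
def GeneratedBy (G : IFG n d) (A : DHS n d) : Prop :=
  ∀ τ : Fin G.T,
    G.helpers τ = A.helpers τ (fun l : Fin (τ + 1) => G.failed (l.castLE τ.isLt))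

end IFG

/-- The minimum, over all information flow graphs `G` that the scheme `A` generates and over all
data collectors `t` of `G`, of the min-cut value between the source and `t`. -/
noncomputable def schemeMinCut {n d : ℕ} (A : DHS n d) (k : ℕ) (α β : ℝ≥0∞) : ℝ≥0∞ :=
  ⨅ (G : IFG n d) (_ : G.GeneratedBy A) (S : {S : Finset (Fin n) // S.card = k}),
    minCut (G.capacity k α β) Vertex.source (Vertex.dc S)

/-- `A` is absolutely optimal for `(n, k, d)`: no dynamic scheme has a larger min-cut value, for
any `(α, β)`. -/
def IsAbsolutelyOptimal {n d : ℕ} (k : ℕ) (A : DHS n d) : Prop :=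
  ∀ (B : DHS n d) (α β : ℝ≥0∞), schemeMinCut B k α β ≤ schemeMinCut A k α β

/-- The helper sets of the family helper selection scheme, for the nodes sorted as `0, …, n - 1`.
Consecutive blocks of `n - d` nodes form the complete families; the remaining `n % (n - d)` nodes
form the incomplete family. A node of a complete family is helped by all nodes outside its family,
and a node of the incomplete family by the first `d` nodes. -/
def familyHelpers (n d : ℕ) (p : Fin n) : Finset (Fin n) :=
  if (p : ℕ) / (n - d) < n / (n - d) then
    Finset.univ.filter fun q : Fin n => (q : ℕ) / (n - d) ≠ (p : ℕ) / (n - d)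
  else
    Finset.univ.filter fun q : Fin n => (q : ℕ) < d

theorem card_familyHelpers {n d : ℕ} (h : d < n) (p : Fin n) :
    (familyHelpers n d p).card = d := by
  unfold familyHelpers
  have hm : 0 < n - d := by omega
  split_ifs with hp
  · have h1 := Finset.card_filter_add_card_filter_not (s := (Finset.univ : Finset (Fin n)))
      (fun q : Fin n => (q : ℕ) / (n - d) = (p : ℕ) / (n - d))
    have h2 : (Finset.univ.filter fun q : Fin n =>
        (q : ℕ) / (n - d) = (p : ℕ) / (n - d)).card = n - d := by
      have hle : ((p : ℕ) / (n - d) + 1) * (n - d) ≤ n :=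
        (Nat.mul_le_mul_right _ hp).trans (Nat.div_mul_le_self _ _)
      rw [← Finset.card_map Fin.valEmbedding]
      have : (Finset.univ.filter fun q : Fin n =>
          (q : ℕ) / (n - d) = (p : ℕ) / (n - d)).map Fin.valEmbedding =
          Finset.Ico ((p : ℕ) / (n - d) * (n - d)) (((p : ℕ) / (n - d) + 1) * (n - d)) := by
        ext x
        simp only [Finset.mem_map, Finset.mem_filter, Finset.mem_univ, true_and,
          Fin.valEmbedding_apply, Finset.mem_Ico]
        rw [← Nat.le_div_iff_mul_le hm, ← Nat.div_lt_iff_lt_mul hm]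
        constructor
        · rintro ⟨q, hq, rfl⟩
          omega
        · intro hx
          have hlt := (Nat.div_lt_iff_lt_mul hm).1 hx.2
          exact ⟨⟨x, by omega⟩, by simp only; omega, rfl⟩
      rw [this, Nat.card_Ico, Nat.succ_mul]
      omega
    rw [h2, Finset.card_univ, Fintype.card_fin] at h1
    simp only [ne_eq]
    omega
  · rw [Fin.card_filter_val_lt]
    omega

theorem notMem_familyHelpers {n d : ℕ} (h : d < n) (p : Fin n) :
    p ∉ familyHelpers n d p := by
  unfold familyHelpers
  have hm : 0 < n - d := by omega
  split_ifs with hp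
  · simp
  · simp only [Finset.mem_filter, Finset.mem_univ, true_and, not_lt]
    have h1 : n / (n - d) * (n - d) ≤ p :=
      (Nat.mul_le_mul_right _ (not_lt.1 hp)).trans (Nat.div_mul_le_self _ _)
    have h2 := Nat.div_add_mod' n (n - d)
    have h3 := Nat.mod_lt n hm
    omega

/-- The family helper selection scheme for `n` nodes and `d` helpers, with respect to an arbitrary
sorting `σ` of the nodes (`σ i` is the position of the node `i`). -/
def fhs {n d : ℕ} (h : d < n) (σ : Equiv.Perm (Fin n)) : SHS n d where
  helpers i := (familyHelpers n d (σ i)).map σ.symm.toEmbedding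
  card_helpers i := by rw [Finset.card_map, card_familyHelpers h]
  failed_notMem i := by
    simpa [Finset.mem_map_equiv] using notMem_familyHelpers h (σ i)

end RegeneratingCode

/-!
Write `f i = min ((d - i) β) α`, and let `bound` denote `2 f 0 + f 2 + ⋯ + f (k - 1)`. Two facts are
shown: every dynamic scheme has min-cut at most `bound`, and the family scheme has min-cut at
least `bound`. Both assertions of the theorem follow.

*Upper bound* (`schemeMinCut_le_bound`). Since `n = d + 2`, every repair leaves out exactly one
surviving node. Let the nodes fail once each, in the order `0, …, n - 1`, and join each newcomer to
the node it leaves out when that one is earlier. This is a forest in which every parent precedes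
its children. The kernel `I` of the forest (a vertex is in `I` iff none of its children is) is
independent and contains at least half of the vertices. If it has at least `n / 2 + 1` elements, a
part of it is a data collector each of whose nodes is helped by all the earlier ones. Otherwise the
parent map is a bijection of `I` onto its complement, and adding to `I` the parent of its first
element creates just one edge, between the first two nodes (`exists_almost_independent`). Hence
the `i`-th node of the data collector is helped by `i` earlier ones for every `i ≠ 1`, and cutting
each of these nodes at the cheaper of its two sides gives a cut of value at most `bound`.

*Lower bound* (`bound_le_schemeMinCut_fhs`). In a cut of finite value, let `P` be the set of the
physical nodes one of whose incarnations has its output on the sink side, ordered by the time at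
which this first happens. That first incarnation of `p` contributes at least `f y` to the cut, where
`y` is the number of helpers of `p` that precede `p` in `P` (`exists_sum_le_cut`). For the family
scheme the families are pairs, and there are `n / 2` of them, so two of the first `n / 2 + 1` nodes
of `P` form a family and do not help each other. Thus the `i`-th node has at most `i` earlier
helpers, and for some `i₀ ≥ 1` at most `i₀ - 1`. As `f` is decreasing and concave, the worst case is
`i₀ = 1` (`bound_le_sum`), which gives `bound`.
-/

namespace RegeneratingCode

/-! ### Ranks in a finite set -/

/-- The number of elements of `J` that strictly precede `x`, for the order given by the keys `r`. -/
def rank {ι : Type*} (r : ι → ℕ) (J : Finset ι) (x : ι) : ℕ :=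
  (J.filter fun q => r q < r x).card

theorem rank_lt_rank {ι : Type*} {r : ι → ℕ} {J : Finset ι} {x y : ι} (hx : x ∈ J)
    (h : r x < r y) : rank r J x < rank r J y := by
  apply Finset.card_lt_card
  rw [Finset.ssubset_iff_of_subset]
  · exact ⟨x, by simp [hx, h], by simp⟩
  · intro q hq
    simp only [Finset.mem_filter] at hq ⊢
    exact ⟨hq.1, hq.2.trans h⟩

theorem rank_injOn {ι : Type*} {r : ι → ℕ} (hr : Function.Injective r) (J : Finset ι) :
    Set.InjOn (rank r J) J := by
  intro x hx y hy h
  rcases lt_trichotomy (r x) (r y) with h1 | h1 | h1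
  · exact absurd h (rank_lt_rank hx h1).ne
  · exact hr h1
  · exact absurd h (rank_lt_rank hy h1).ne'

theorem rank_lt_card {ι : Type*} (r : ι → ℕ) {J : Finset ι} {x : ι} (hx : x ∈ J) :
    rank r J x < J.card := by
  apply Finset.card_lt_card
  rw [Finset.ssubset_iff_of_subset (Finset.filter_subset _ _)]
  exact ⟨x, hx, by simp⟩

theorem image_rank {ι : Type*} {r : ι → ℕ} (hr : Function.Injective r) (J : Finset ι) :
    J.image (rank r J) = Finset.range J.card := by
  apply Finset.eq_of_subset_of_card_le
  · intro i hi
    obtain ⟨x, hx, rfl⟩ := Finset.mem_image.1 hi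
    exact Finset.mem_range.2 (rank_lt_card r hx)
  · rw [Finset.card_range, Finset.card_image_of_injOn (rank_injOn hr J)]

theorem sum_rank {ι M : Type*} [AddCommMonoid M] {r : ι → ℕ} (hr : Function.Injective r)
    (J : Finset ι) (g : ℕ → M) :
    ∑ x ∈ J, g (rank r J x) = ∑ i ∈ Finset.range J.card, g i := by
  rw [← image_rank hr J, Finset.sum_image (rank_injOn hr J)]

/-- The first `k` elements of a finite set. -/
theorem exists_initial_subset {ι : Type*} {r : ι → ℕ} (hr : Function.Injective r)
    (P : Finset ι) {k : ℕ} (hk : k ≤ P.card) :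
    ∃ Q ⊆ P, Q.card = k ∧ ∀ q ∈ Q, ∀ p ∈ P, r p < r q → p ∈ Q := by
  refine ⟨P.filter fun x => rank r P x < k, Finset.filter_subset _ _, ?_, ?_⟩
  · rw [Finset.card_filter, sum_rank hr P fun i => if i < k then 1 else 0, ← Finset.card_filter]
    have : (Finset.range P.card).filter (· < k) = Finset.range k := by
      ext i
      simp only [Finset.mem_filter, Finset.mem_range]
      omega
    rw [this, Finset.card_range]
  · intro q hq p hp h
    rw [Finset.mem_filter] at hq ⊢
    exact ⟨hp, (rank_lt_rank hp h).trans hq.2⟩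

/-! ### The bound -/

/-- The least contribution to a cut of a node when `i` of its `d` helpers are on the sink side. -/
noncomputable def contrib (d : ℕ) (α β : ℝ≥0∞) (i : ℕ) : ℝ≥0∞ :=
  min (((d - i : ℕ) : ℝ≥0∞) * β) α

theorem contrib_antitone (d : ℕ) (α β : ℝ≥0∞) : Antitone (contrib d α β) := by
  intro i j h
  unfold contrib
  gcongr

/-- The common min-cut value of the optimal schemes. -/
noncomputable def bound (d k : ℕ) (α β : ℝ≥0∞) : ℝ≥0∞ :=
  (∑ i ∈ Finset.Icc 2 (k - 1), contrib d α β i) + 2 * contrib d α β 0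

theorem sum_range_eq_add_sum_Icc {k : ℕ} (hk : 2 ≤ k) (g : ℕ → ℝ≥0∞) :
    ∑ i ∈ Finset.range k, g i = g 0 + g 1 + ∑ i ∈ Finset.Icc 2 (k - 1), g i := by
  have h : Finset.Icc 2 (k - 1) = Finset.Ico 2 k := by
    ext i
    simp only [Finset.mem_Icc, Finset.mem_Ico]
    omega
  rw [h, ← Finset.sum_range_add_sum_Ico g hk, Finset.sum_range_succ, Finset.sum_range_one]

theorem sum_contrib_eq_bound {d k : ℕ} (hk : 2 ≤ k) (α β : ℝ≥0∞) :
    ∑ i ∈ Finset.range k, contrib d α β (if i = 1 then 0 else i) = bound d k α β := by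
  rw [sum_range_eq_add_sum_Icc hk, bound, add_comm]
  congr 1
  · refine Finset.sum_congr rfl fun i hi => ?_
    rw [Finset.mem_Icc] at hi
    rw [if_neg (by omega)]
  · simp [two_mul]

/-- Concavity of `x ↦ min (x β) α`. -/
theorem min_mul_concave {a b : ℕ} (hab : a ≤ b) (α β : ℝ≥0∞) :
    min (((b + 1 : ℕ) : ℝ≥0∞) * β) α + min ((a : ℝ≥0∞) * β) α ≤
      min ((b : ℝ≥0∞) * β) α + min (((a + 1 : ℕ) : ℝ≥0∞) * β) α := by
  rcases le_total α ((b : ℝ≥0∞) * β) with h | h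
  · rw [min_eq_right h]
    gcongr
    · exact min_le_right _ _
    · omega
  rw [min_eq_left h]
  rcases le_total α (((a + 1 : ℕ) : ℝ≥0∞) * β) with h' | h'
  · rw [min_eq_right h', add_comm]
    refine add_le_add ((min_le_left _ _).trans ?_) (min_le_right _ _)
    gcongr
  · rw [min_eq_left h']
    refine (add_le_add (min_le_left _ _) (min_le_left _ _)).trans (le_of_eq ?_)
    push_cast
    ring

theorem contrib_zero_add_le {d i : ℕ} (hi : 1 ≤ i) (hid : i ≤ d) (α β : ℝ≥0∞) :
    contrib d α β 0 + contrib d α β i ≤ contrib d α β 1 + contrib d α β (i - 1) := by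
  have h := min_mul_concave (a := d - i) (b := d - 1) (by omega) α β
  rw [show d - 1 + 1 = d - 0 by omega, show d - i + 1 = d - (i - 1) by omega] at h
  exact h

/-- Moving the node with one earlier helper fewer from position `i₀` to position `1` does not increase
the sum. -/
theorem bound_le_sum {d k i₀ : ℕ} (h1 : 1 ≤ i₀) (hik : i₀ < k) (hid : i₀ ≤ d) (α β : ℝ≥0∞) :
    bound d k α β ≤
      ∑ i ∈ Finset.range k, contrib d α β (if i = i₀ then i₀ - 1 else i) := by
  rcases h1.eq_or_lt with rfl | h2
  · exact (sum_contrib_eq_bound (by omega) α β).ge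
  have hmem : i₀ ∈ Finset.Icc 2 (k - 1) := by
    rw [Finset.mem_Icc]
    omega
  have hrest : ∑ i ∈ (Finset.Icc 2 (k - 1)).erase i₀,
      contrib d α β (if i = i₀ then i₀ - 1 else i) =
      ∑ i ∈ (Finset.Icc 2 (k - 1)).erase i₀, contrib d α β i :=
    Finset.sum_congr rfl fun i hi => by rw [if_neg (Finset.ne_of_mem_erase hi)]
  rw [sum_range_eq_add_sum_Icc (by omega), bound, ← Finset.add_sum_erase _ _ hmem,
    ← Finset.add_sum_erase _ _ hmem, hrest, if_neg (by omega), if_neg (by omega), if_pos rfl]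
  calc contrib d α β i₀ + ∑ i ∈ (Finset.Icc 2 (k - 1)).erase i₀, contrib d α β i +
        2 * contrib d α β 0
      = contrib d α β 0 + (contrib d α β 0 + contrib d α β i₀) +
        ∑ i ∈ (Finset.Icc 2 (k - 1)).erase i₀, contrib d α β i := by ring
    _ ≤ contrib d α β 0 + (contrib d α β 1 + contrib d α β (i₀ - 1)) +
        ∑ i ∈ (Finset.Icc 2 (k - 1)).erase i₀, contrib d α β i := by
        gcongr ?_ + _
        exact add_le_add_right (contrib_zero_add_le h1 hid α β) _
    _ = _ := by ring

/-! ### Almost independent sets in forests -/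

/-- The kernel of the forest in which the parent of `c` is `e c`, when `e c < c`. -/
theorem exists_kernel {n : ℕ} (e : Fin n → Fin n) :
    ∃ I : Finset (Fin n), ∀ p, p ∈ I ↔ ∀ c, p < c → e c = p → c ∉ I := by
  classical
  let step : (p : Fin n) → ((c : Fin n) → p < c → Prop) → Prop :=
    fun p ih => ∀ c (h : p < c), e c = p → ¬ ih c h
  let K : Fin n → Prop := (wellFounded_gt (α := Fin n)).fix step
  have hK : ∀ p, K p ↔ ∀ c, p < c → e c = p → ¬ K c := fun p =>
    iff_of_eq ((wellFounded_gt (α := Fin n)).fix_eq step p)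
  exact ⟨Finset.univ.filter K, fun p => by simpa using hK p⟩

/-- A forest on `2 m` vertices, each parent `e x` preceding its child `x`, has `m + 1` vertices
that span no edge except possibly one between the first two of them. -/
theorem exists_almost_independent {n m : ℕ} (hn : n = 2 * m) (hm : 1 ≤ m) (e : Fin n → Fin n) :
    ∃ J : Finset (Fin n), J.card = m + 1 ∧
      ∀ x ∈ J, e x ∈ J → e x < x → rank Fin.val J x = 1 := by
  obtain ⟨I, hI⟩ := exists_kernel e
  have hind : ∀ x ∈ I, e x ∈ I → ¬ e x < x := fun x hx he hlt => (hI _).1 he x hlt rfl hx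
  have hsub : Iᶜ ⊆ (I.filter fun c => e c < c).image e := by
    intro p hp
    rw [Finset.mem_compl, hI] at hp
    push Not at hp
    obtain ⟨c, hpc, rfl, hc⟩ := hp
    exact Finset.mem_image_of_mem e (Finset.mem_filter.2 ⟨hc, hpc⟩)
  have hadd := Finset.card_add_card_compl I
  rw [Fintype.card_fin] at hadd
  have h1 := Finset.card_le_card hsub
  have h2 : ((I.filter fun c => e c < c).image e).card ≤ (I.filter fun c => e c < c).card :=
    Finset.card_image_le
  have h3 : (I.filter fun c => e c < c).card ≤ I.card := Finset.card_filter_le _ _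
  by_cases hlarge : m + 1 ≤ I.card
  · obtain ⟨J, hJI, hJ⟩ := Finset.exists_subset_card_eq hlarge
    exact ⟨J, hJ, fun x hx he hlt => absurd hlt (hind x (hJI hx) (hJI he))⟩
  -- All the inequalities between cardinalities are equalities: `e` maps `I` bijectively onto `Iᶜ`.
  have hall : (I.filter fun c => e c < c) = I :=
    Finset.eq_of_subset_of_card_le (Finset.filter_subset _ _) (by omega)
  have hpar : ∀ c ∈ I, e c < c := Finset.filter_eq_self.1 hall
  rw [hall] at h1 h2
  have hinj : Set.InjOn e I := Finset.card_image_iff.1 (by omega)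
  have hne : I.Nonempty := Finset.card_pos.1 (by omega)
  set c := I.min' hne with hc
  have hcI : c ∈ I := I.min'_mem hne
  have hcmin : ∀ x ∈ I, c ≤ x := fun x hx => I.min'_le x hx
  have hec : e c ∉ I := fun h => hind c hcI h (hpar c hcI)
  refine ⟨insert (e c) I, by rw [Finset.card_insert_of_notMem hec]; omega, ?_⟩
  intro x hx hex hlt
  rw [Finset.mem_insert] at hx hex
  have hxc : x = c := by
    rcases hx with rfl | hx
    · rcases hex with h | h
      · exact absurd h hlt.ne
      · exact absurd ((hcmin _ h).trans_lt (hlt.trans (hpar c hcI))) (lt_irrefl _)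
    · rcases hex with h | h
      · exact hinj hx hcI h
      · exact absurd hlt (hind x hx h)
  rw [hxc, rank, Finset.card_eq_one]
  refine ⟨e c, ?_⟩
  ext q
  simp only [Finset.mem_filter, Finset.mem_insert, Finset.mem_singleton, Fin.val_fin_lt]
  constructor
  · rintro ⟨rfl | hq, hlt'⟩
    · rfl
    · exact absurd (hcmin q hq) (not_le.2 hlt')
  · rintro rfl
    exact ⟨Or.inl rfl, hpar c hcI⟩

/-! ### The upper bound for dynamic schemes -/

/-- The information flow graph of the scheme `A` when the nodes fail once each, in order. It is
reducible, so that its number of repairs unfolds to `n` and nodes can serve as repair times. -/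
abbrev roundRobin {n d : ℕ} (A : DHS n d) : IFG n d where
  T := n
  failed := id
  helpers τ := A.helpers τ fun l => l.castLE τ.isLt
  card_helpers _ := A.card_helpers _ _
  failed_notMem τ := A.failed_notMem τ fun l => l.castLE τ.isLt

theorem roundRobin_generatedBy {n d : ℕ} (A : DHS n d) : (roundRobin A).GeneratedBy A :=
  fun _ => rfl

theorem roundRobin_active_of_lt {n d : ℕ} (A : DHS n d) {m : ℕ} {i : Fin n} (h : (i : ℕ) < m) :
    (roundRobin A).active m i = Sum.inr (i : Fin n) := by
  induction m with
  | zero => omega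
  | succ m ih =>
    rw [IFG.active]
    by_cases hi : (i : ℕ) = m
    · subst hi
      have hT : (i : ℕ) < (roundRobin A).T := i.isLt
      rw [dif_pos hT]
      exact if_pos rfl
    · have := ih (by omega)
      split_ifs with h1 h2
      · exact absurd (congrArg Fin.val h2).symm hi
      · exact this
      · exact this

/-- Cutting each node of the data collector `J` at the cheaper of its two sides. -/
theorem minCut_roundRobin_le {n d k : ℕ} (A : DHS n d) (α β : ℝ≥0∞) (J : Finset (Fin n))
    (hJ : J.card = k) :
    minCut ((roundRobin A).capacity k α β) .source (.dc ⟨J, hJ⟩) ≤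
      ∑ x ∈ J, contrib d α β
        ((((roundRobin A).helpers x).filter fun q => q ∈ J ∧ q < x).card) := by
  set y : Fin n → ℕ := fun x => (((roundRobin A).helpers x).filter fun q => q ∈ J ∧ q < x).card with hy
  set c := (roundRobin A).capacity k α β with hc
  let outs : Finset (Vertex n k n) := J.image fun x : Fin n => Vertex.out (Sum.inr x)
  let cheap : Finset (Fin n) := J.filter fun x => ((d - y x : ℕ) : ℝ≥0∞) * β ≤ α
  let inps : Finset (Vertex n k n) := cheap.image fun x : Fin n => Vertex.inp (Sum.inr x)
  let W : Finset (Vertex n k n) := insert (Vertex.dc ⟨J, hJ⟩) (outs ∪ inps)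
  have hout : ∀ x ∈ J, (Vertex.out (Sum.inr x) : Vertex n k n) ∈ W := fun x hx =>
    Finset.mem_insert_of_mem (Finset.mem_union_left _ (Finset.mem_image_of_mem _ hx))
  have hinp : ∀ x ∈ cheap, (Vertex.inp (Sum.inr x) : Vertex n k n) ∈ W := fun x hx =>
    Finset.mem_insert_of_mem (Finset.mem_union_right _ (Finset.mem_image_of_mem _ hx))
  have hsource : Vertex.source ∈ Wᶜ := by
    simp [W, outs, inps]
  have hdc : Vertex.dc ⟨J, hJ⟩ ∉ Wᶜ := by simp [W]
  refine (iInf_le_of_le Wᶜ (iInf₂_le hsource hdc)).trans ?_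
  rw [Finset.sum_comm, compl_compl]
  -- No edge that enters the data collector is cut.
  have wdc : ∑ u ∈ Wᶜ, c u (.dc ⟨J, hJ⟩) = 0 := by
    refine Finset.sum_eq_zero fun u hu => ?_
    cases u with
    | out x =>
      rw [hc]
      simp only [IFG.capacity]
      rw [if_neg]
      rintro ⟨i, hi, hx⟩
      rw [roundRobin_active_of_lt A i.isLt] at hx
      subst hx
      exact Finset.mem_compl.1 hu (hout i hi)
    | source => rfl
    | inp _ => rfl
    | dc _ => rfl
  have wout : ∀ x ∈ J, ∑ u ∈ Wᶜ, c u (.out (Sum.inr x)) ≤ if x ∈ cheap then 0 else α := by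
    intro x hx
    have hle : ∀ u, u ≠ Vertex.inp (Sum.inr x) → c u (.out (Sum.inr x)) = 0 := by
      intro u hu
      cases u with
      | inp z =>
        have hz : z ≠ Sum.inr x := fun h => hu (by rw [h])
        exact if_neg hz
      | source => rfl
      | out _ => rfl
      | dc _ => rfl
    split_ifs with hcheap
    · refine (Finset.sum_eq_zero fun u hu => hle u ?_).le
      rintro rfl
      exact Finset.mem_compl.1 hu (hinp x hcheap)
    · calc ∑ u ∈ Wᶜ, c u (.out (Sum.inr x)) ≤ ∑ u, c u (.out (Sum.inr x)) :=
            Finset.sum_le_sum_of_subset (Finset.subset_univ _)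
        _ = c (.inp (Sum.inr x)) (.out (Sum.inr x)) :=
            Finset.sum_eq_single _ (fun u _ hu => hle u hu) (by simp)
        _ = α := if_pos rfl
  have winp : ∀ x ∈ cheap,
      ∑ u ∈ Wᶜ, c u (.inp (Sum.inr x)) ≤ ((d - y x : ℕ) : ℝ≥0∞) * β := by
    intro x _
    set H := ((roundRobin A).helpers x).filter fun q => ¬ (q ∈ J ∧ q < x) with hH
    have hcard : H.card = d - y x := by
      have h := Finset.card_filter_add_card_filter_not (s := (roundRobin A).helpers x)
        (fun q : Fin n => q ∈ J ∧ q < x)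
      rw [(roundRobin A).card_helpers x] at h
      change y x + H.card = d at h
      omega
    set N : Finset (Vertex n k n) := H.image fun q => Vertex.out ((roundRobin A).active x q)
    have hzero : ∀ u ∈ Wᶜ, u ∉ N → c u (.inp (Sum.inr x)) = 0 := by
      intro u hu hN
      cases u with
      | out z =>
        refine if_neg ?_
        rintro ⟨q, hq, rfl⟩
        by_cases hqx : q ∈ J ∧ q < x
        · rw [roundRobin_active_of_lt A (Fin.lt_def.1 hqx.2)] at hu
          exact Finset.mem_compl.1 hu (hout q hqx.1)
        · exact hN (Finset.mem_image_of_mem _ (Finset.mem_filter.2 ⟨hq, hqx⟩))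
      | source => rfl
      | inp _ => rfl
      | dc _ => rfl
    have hβ : ∀ u ∈ N, c u (.inp (Sum.inr x)) ≤ β := by
      intro u hu
      obtain ⟨q, _, rfl⟩ := Finset.mem_image.1 hu
      rw [hc]
      simp only [IFG.capacity]
      split_ifs <;> simp
    calc ∑ u ∈ Wᶜ, c u (.inp (Sum.inr x))
        = ∑ u ∈ Wᶜ.filter (· ∈ N), c u (.inp (Sum.inr x)) := by
          refine (Finset.sum_filter_of_ne fun u hu hne => ?_).symm
          by_contra hN
          exact hne (hzero u hu hN)
      _ ≤ ∑ u ∈ N, c u (.inp (Sum.inr x)) :=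
          Finset.sum_le_sum_of_subset fun u hu => (Finset.mem_filter.1 hu).2
      _ ≤ N.card • β := Finset.sum_le_card_nsmul _ _ _ hβ
      _ ≤ ((d - y x : ℕ) : ℝ≥0∞) * β := by
          rw [nsmul_eq_mul, ← hcard]
          gcongr
          exact Finset.card_image_le
  calc ∑ v ∈ W, ∑ u ∈ Wᶜ, c u v
      ≤ ∑ x ∈ J, (if x ∈ cheap then 0 else α) + ∑ x ∈ cheap, ((d - y x : ℕ) : ℝ≥0∞) * β := by
        have hnot : Vertex.dc ⟨J, hJ⟩ ∉ outs ∪ inps := by simp [outs, inps]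
        have hdisj : Disjoint outs inps := by
          rw [Finset.disjoint_left]
          intro v hv hv'
          obtain ⟨x, _, rfl⟩ := Finset.mem_image.1 hv
          obtain ⟨z, _, h⟩ := Finset.mem_image.1 hv'
          cases h
        rw [Finset.sum_insert hnot, wdc, zero_add, Finset.sum_union hdisj,
          Finset.sum_image (fun x _ z _ h => Sum.inr.inj (Vertex.out.inj h)),
          Finset.sum_image (fun x _ z _ h => Sum.inr.inj (Vertex.inp.inj h))]
        exact add_le_add (Finset.sum_le_sum wout) (Finset.sum_le_sum winp)
    _ = ∑ x ∈ J, contrib d α β (y x) := by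
        rw [Finset.sum_filter, ← Finset.sum_add_distrib]
        refine Finset.sum_congr rfl fun x hx => ?_
        simp only [cheap, Finset.mem_filter, hx, true_and, contrib]
        split_ifs with h
        · rw [zero_add, min_eq_left h]
        · rw [add_zero, min_eq_right (not_le.1 h).le]

theorem schemeMinCut_le_of_generatedBy {n d k : ℕ} {A : DHS n d} {G : IFG n d}
    (hG : G.GeneratedBy A) (α β : ℝ≥0∞) (S : {S : Finset (Fin n) // S.card = k}) :
    schemeMinCut A k α β ≤ minCut (G.capacity k α β) .source (.dc S) :=
  iInf_le_of_le G (iInf_le_of_le hG (iInf_le _ S))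

theorem schemeMinCut_le_bound {n k d m : ℕ} (hn : n = d + 2) (hm : n = 2 * m) (hm1 : 1 ≤ m)
    (hk : k = m + 1) (A : DHS n d) (α β : ℝ≥0∞) :
    schemeMinCut A k α β ≤ bound d k α β := by
  -- `e x` is the node that the newcomer `x` leaves out.
  have hex : ∀ x : Fin n, ∃ e, ∀ q, q ≠ x → q ≠ e → q ∈ (roundRobin A).helpers x := by
    intro x
    have hcard : (((roundRobin A).helpers x)ᶜ.erase x).card = 1 := by
      have hx : x ∈ ((roundRobin A).helpers x)ᶜ := Finset.mem_compl.2 ((roundRobin A).failed_notMem x)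
      rw [Finset.card_erase_of_mem hx, Finset.card_compl, Fintype.card_fin, (roundRobin A).card_helpers x]
      omega
    obtain ⟨e, he⟩ := Finset.card_eq_one.1 hcard
    refine ⟨e, fun q hqx hqe => ?_⟩
    by_contra hq
    have : q ∈ ((roundRobin A).helpers x)ᶜ.erase x := Finset.mem_erase.2 ⟨hqx, Finset.mem_compl.2 hq⟩
    rw [he, Finset.mem_singleton] at this
    exact hqe this
  choose e he using hex
  obtain ⟨J, hJ, hrank⟩ := exists_almost_independent hm hm1 e
  rw [← hk] at hJ
  have hcut := (schemeMinCut_le_of_generatedBy (roundRobin_generatedBy A) α β ⟨J, hJ⟩).trans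
    (minCut_roundRobin_le A α β J hJ)
  refine hcut.trans ?_
  calc _
      ≤ ∑ x ∈ J, contrib d α β
          (if rank Fin.val J x = 1 then 0 else rank Fin.val J x) := by
        refine Finset.sum_le_sum fun x hx => contrib_antitone d α β ?_
        split_ifs with h
        · exact Nat.zero_le _
        · refine Finset.card_le_card fun q hq => ?_
          rw [Finset.mem_filter, Fin.val_fin_lt] at hq
          refine Finset.mem_filter.2 ⟨he x q hq.2.ne ?_, hq⟩
          rintro rfl
          exact h (hrank x hx hq.1 hq.2)
    _ = bound d k α β := by
        rw [sum_rank Fin.val_injective J fun i => contrib d α β (if i = 1 then 0 else i), hJ,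
          sum_contrib_eq_bound (by omega)]

/-! ### Cuts in the graphs of a stationary scheme -/

namespace IFG

variable {n d : ℕ}

/-- The physical node that a storage node is an incarnation of. -/
def phys (G : IFG n d) : StorageNode n G.T → Fin n
  | Sum.inl i => i
  | Sum.inr τ => G.failed τ

theorem phys_active (G : IFG n d) (m : ℕ) (i : Fin n) : G.phys (G.active m i) = i := by
  induction m with
  | zero => rfl
  | succ m ih =>
    rw [active]
    split_ifs with h1 h2
    · exact h2
    · exact ih
    · exact ih

/-- A change of the active incarnation of `i` is a repair of `i`. -/
theorem exists_of_active_succ_ne (G : IFG n d) {m : ℕ} {i : Fin n}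
    (h : G.active (m + 1) i ≠ G.active m i) :
    ∃ hm : m < G.T, G.failed ⟨m, hm⟩ = i ∧ G.active (m + 1) i = Sum.inr ⟨m, hm⟩ := by
  rw [active] at h ⊢
  split_ifs at h ⊢ with h1 h2
  · exact ⟨h1, h2, rfl⟩
  · exact absurd rfl h
  · exact absurd rfl h

end IFG

/-- A cut is bounded below by the contributions of `k` nodes, each of which loses at most the
helpers that precede it. -/
theorem exists_sum_le_cut {n k d : ℕ} (A : SHS n d) (G : IFG n d) (hG : G.GeneratedBy A.toDHS)
    (α β : ℝ≥0∞) (S : {S : Finset (Fin n) // S.card = k}) (U : Finset (Vertex n k G.T))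
    (hs : Vertex.source ∈ U) (ht : Vertex.dc S ∉ U)
    (hfin : ∑ u ∈ U, ∑ v ∈ Uᶜ, G.capacity k α β u v ≠ ∞) :
    ∃ (r : Fin n → ℕ) (Q : Finset (Fin n)), Function.Injective r ∧ Q.card = k ∧
      ∑ p ∈ Q, contrib d α β (((A.helpers p).filter fun q => q ∈ Q ∧ r q < r p).card) ≤
        ∑ u ∈ U, ∑ v ∈ Uᶜ, G.capacity k α β u v := by
  classical
  rw [Finset.sum_comm] at hfin ⊢
  set c := G.capacity k α β with hc
  set w : Vertex n k G.T → ℝ≥0∞ := fun v => ∑ u ∈ U, c u v with hw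
  have hcw : ∀ u ∈ U, ∀ v, c u v ≤ w v := fun u hu v =>
    Finset.single_le_sum (f := fun u => c u v) (fun _ _ => zero_le) hu
  have hnot_top : ∀ v ∉ U, w v ≠ ∞ := fun v hv h => hfin (by
    refine top_le_iff.1 (h.symm.le.trans ?_)
    exact Finset.single_le_sum (f := w) (fun _ _ => zero_le) (Finset.mem_compl.2 hv))
  have hact : ∀ p ∈ S.1, Vertex.out (G.active G.T p) ∉ U := by
    intro p hp hU
    refine hnot_top _ ht (top_le_iff.1 (le_trans (le_of_eq ?_) (hcw _ hU _)))
    exact (if_pos ⟨p, hp, rfl⟩).symm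
  let P : Finset (Fin n) := Finset.univ.filter fun p => ∃ m, Vertex.out (G.active m p) ∉ U
  -- `t p` is the first time at which the output of the active incarnation of `p ∈ P` is outside
  -- `U`; `r` orders `P` by `t` and breaks ties.
  let t : Fin n → ℕ := fun p => sInf {m | Vertex.out (G.active m p) ∉ U}
  have ht_mem : ∀ p ∈ P, Vertex.out (G.active (t p) p) ∉ U := fun p hp =>
    Nat.sInf_mem (s := {m | Vertex.out (G.active m p) ∉ U}) (Finset.mem_filter.1 hp).2
  have ht_le : ∀ p m, Vertex.out (G.active m p) ∉ U → t p ≤ m := fun p m h =>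
    Nat.sInf_le h
  let r : Fin n → ℕ := fun p => t p * n + p
  have hr_lt : ∀ p q, t p < t q → r p < r q := by
    intro p q h
    have h1 : (t p + 1) * n ≤ t q * n := Nat.mul_le_mul_right n h
    have h2 := p.isLt
    rw [Nat.succ_mul] at h1
    simp only [r]
    omega
  have hr : Function.Injective r := by
    intro p q h
    rcases lt_trichotomy (t p) (t q) with h1 | h1 | h1
    · exact absurd h (hr_lt _ _ h1).ne
    · simp only [r, h1] at h
      exact Fin.ext (by omega)
    · exact absurd h (hr_lt _ _ h1).ne'
  have hSP : S.1 ⊆ P := fun p hp => Finset.mem_filter.2 ⟨Finset.mem_univ _, _, hact p hp⟩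
  have hkP : k ≤ P.card := S.2 ▸ Finset.card_le_card hSP
  obtain ⟨Q, hQP, hQk, hQ⟩ := exists_initial_subset hr P hkP
  refine ⟨r, Q, hr, hQk, ?_⟩
  let x : Fin n → StorageNode n G.T := fun p => G.active (t p) p
  -- The end of a cut edge at the node `x p`.
  let v : Fin n → Vertex n k G.T := fun p =>
    if Vertex.inp (x p) ∈ U then Vertex.out (x p) else Vertex.inp (x p)
  have hv_inj : Set.InjOn v Q := by
    intro p _ q _ h
    have hx : x p = x q := by
      simp only [v] at h
      split_ifs at h <;> simpa using h
    have := congrArg G.phys hx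
    simpa only [x, IFG.phys_active] using this
  have hv_mem : ∀ p ∈ Q, v p ∈ Uᶜ := by
    intro p hp
    rw [Finset.mem_compl]
    simp only [v]
    split_ifs with h
    · exact ht_mem p (hQP hp)
    · exact h
  have hw_le : ∀ p ∈ Q,
      contrib d α β (((A.helpers p).filter fun q => q ∈ Q ∧ r q < r p).card) ≤ w (v p) := by
    intro p hp
    simp only [v]
    split_ifs with h
    · refine (min_le_right _ _).trans (le_trans (le_of_eq ?_) (hcw _ h _))
      exact (if_pos rfl).symm
    refine (min_le_left _ _).trans ?_
    rcases Nat.eq_zero_or_pos (t p) with h0 | hpos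
    · have hx : x p = Sum.inl p := by simp only [x, h0, IFG.active]
      rw [hx] at h ⊢
      exact absurd (top_le_iff.1 (hcw _ hs (.inp (Sum.inl p)))) (hnot_top _ h)
    obtain ⟨m, hm⟩ : ∃ m, t p = m + 1 := ⟨t p - 1, by omega⟩
    have hne : G.active (m + 1) p ≠ G.active m p := by
      intro heq
      have h1 := ht_mem p (hQP hp)
      rw [hm, heq] at h1
      have := ht_le p m h1
      omega
    obtain ⟨hmT, hfail, hact_p⟩ := G.exists_of_active_succ_ne hne
    have hx : x p = Sum.inr ⟨m, hmT⟩ := by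
      simp only [x, hm]
      exact hact_p
    have hhelp : G.helpers ⟨m, hmT⟩ = A.helpers p := by
      rw [hG ⟨m, hmT⟩]
      exact congrArg A.helpers hfail
    set H := (A.helpers p).filter fun q => ¬ (q ∈ Q ∧ r q < r p) with hH
    have hcard : H.card = d - ((A.helpers p).filter fun q => q ∈ Q ∧ r q < r p).card := by
      have h := Finset.card_filter_add_card_filter_not (s := A.helpers p)
        (fun q => q ∈ Q ∧ r q < r p)
      rw [A.card_helpers p, ← hH] at h
      omega
    -- A helper on the sink side is in `P`, precedes `p`, and so belongs to `Q`.
    have hHU : ∀ q ∈ H, Vertex.out (G.active m q) ∈ U := by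
      intro q hq
      by_contra hqU
      have hlt : r q < r p := hr_lt q p (by have := ht_le q m hqU; omega)
      have hqP : q ∈ P := Finset.mem_filter.2 ⟨Finset.mem_univ _, m, hqU⟩
      exact (Finset.mem_filter.1 hq).2 ⟨hQ p hp q hqP hlt, hlt⟩
    rw [hx]
    calc ((d - ((A.helpers p).filter fun q => q ∈ Q ∧ r q < r p).card : ℕ) : ℝ≥0∞) * β
        = ∑ q ∈ H, β := by rw [← hcard, Finset.sum_const, nsmul_eq_mul]
      _ = ∑ q ∈ H, c (.out (G.active m q)) (.inp (Sum.inr ⟨m, hmT⟩)) := by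
          refine Finset.sum_congr rfl fun q hq => (if_pos ⟨q, ?_, rfl⟩).symm
          rw [hhelp]
          exact (Finset.mem_filter.1 hq).1
      _ = ∑ u ∈ H.image fun q => Vertex.out (G.active m q),
            c u (.inp (Sum.inr ⟨m, hmT⟩)) := by
          rw [Finset.sum_image]
          intro q _ q' _ h
          have := congrArg G.phys (Vertex.out.inj h)
          simpa only [IFG.phys_active] using this
      _ ≤ w (.inp (Sum.inr ⟨m, hmT⟩)) :=
          Finset.sum_le_sum_of_subset (Finset.image_subset_iff.2 hHU)
  calc _ ≤ ∑ p ∈ Q, w (v p) := Finset.sum_le_sum hw_le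
    _ = ∑ z ∈ Q.image v, w z := (Finset.sum_image hv_inj).symm
    _ ≤ ∑ z ∈ Uᶜ, w z := Finset.sum_le_sum_of_subset (Finset.image_subset_iff.2 hv_mem)

/-! ### The lower bound for the family scheme -/

/-- When the families are pairs, nodes of the same family do not help each other. -/
theorem notMem_helpers_fhs {n d m : ℕ} (h : d < n) (hn : n = d + 2) (hm : n = 2 * m)
    (σ : Equiv.Perm (Fin n)) {p q : Fin n} (hpq : (σ p : ℕ) / 2 = (σ q : ℕ) / 2) :
    q ∉ (fhs h σ).helpers p := by
  have h2 : n - d = 2 := by omega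
  have hlt : (σ p : ℕ) / 2 < n / 2 := by
    have := (σ p).isLt
    omega
  rw [hpq] at hlt
  simp [fhs, Finset.mem_map_equiv, familyHelpers, h2, hlt, hpq]

theorem bound_le_schemeMinCut_fhs {n k d m : ℕ} (h : d < n) (hn : n = d + 2) (hm : n = 2 * m)
    (hm2 : 2 ≤ m) (hk : k = m + 1) (σ : Equiv.Perm (Fin n)) (α β : ℝ≥0∞) :
    bound d k α β ≤ schemeMinCut (fhs h σ).toDHS k α β := by
  refine le_iInf₂ fun G hG => le_iInf fun S => le_iInf fun U => le_iInf₂ fun hs ht => ?_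
  by_cases hfin : ∑ u ∈ U, ∑ v ∈ Uᶜ, G.capacity k α β u v = ∞
  · rw [hfin]
    exact le_top
  obtain ⟨r, Q, hr, hQ, hle⟩ := exists_sum_le_cut (fhs h σ) G hG α β S U hs ht hfin
  refine le_trans ?_ hle
  -- Two of the `m + 1` nodes of `Q` belong to the same one of the `m` families.
  obtain ⟨a, b, ha, hb, hab, hfam⟩ : ∃ a b, a ∈ Q ∧ b ∈ Q ∧ r a < r b ∧
      (σ b : ℕ) / 2 = (σ a : ℕ) / 2 := by
    have hmaps : ∀ q ∈ Q, (σ q : ℕ) / 2 ∈ Finset.range m := by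
      intro q _
      have := (σ q).isLt
      rw [Finset.mem_range]
      omega
    obtain ⟨a, ha, b, hb, hne, hfam⟩ := Finset.exists_ne_map_eq_of_card_lt_of_maps_to
      (by rw [Finset.card_range]; omega) hmaps
    rcases lt_or_gt_of_ne (hr.ne hne) with hlt | hlt
    · exact ⟨a, b, ha, hb, hlt, hfam.symm⟩
    · exact ⟨b, a, hb, ha, hlt, hfam⟩
  have hbk : rank r Q b < k := hQ ▸ rank_lt_card r hb
  have hb1 : 1 ≤ rank r Q b := (Nat.zero_le _).trans_lt (rank_lt_rank ha hab)
  calc bound d k α β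
      ≤ ∑ i ∈ Finset.range k,
          contrib d α β (if i = rank r Q b then rank r Q b - 1 else i) :=
        bound_le_sum hb1 hbk (by omega) α β
    _ = ∑ p ∈ Q, contrib d α β
          (if rank r Q p = rank r Q b then rank r Q b - 1 else rank r Q p) := by
        rw [sum_rank hr Q fun i =>
          contrib d α β (if i = rank r Q b then rank r Q b - 1 else i), hQ]
    _ ≤ _ := by
        refine Finset.sum_le_sum fun p hp => contrib_antitone d α β ?_
        split_ifs with hpb
        · obtain rfl := rank_injOn hr Q hp hb hpb
          have hmem : a ∈ Q.filter fun q => r q < r p := Finset.mem_filter.2 ⟨ha, hab⟩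
          rw [rank, ← Finset.card_erase_of_mem hmem]
          refine Finset.card_le_card fun q hq => ?_
          rw [Finset.mem_filter] at hq
          refine Finset.mem_erase.2 ⟨?_, Finset.mem_filter.2 hq.2⟩
          rintro rfl
          exact notMem_helpers_fhs h hn hm σ hfam hq.1
        · exact Finset.card_le_card fun q hq =>
            Finset.mem_filter.2 (Finset.mem_filter.1 hq).2

end RegeneratingCode

theorem mainTheorem2 (n k d : ℕ) (hd : 1 ≤ d) (hdn : d < n)
    (hd_even : Even d) (hn : n = d + 2) (hk : k = n / 2 + 1)
    (σ : Equiv.Perm (Fin n)) :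
    RegeneratingCode.IsAbsolutelyOptimal k (RegeneratingCode.fhs hdn σ).toDHS ∧
      ∀ α β : ℝ≥0∞,
        RegeneratingCode.schemeMinCut (RegeneratingCode.fhs hdn σ).toDHS k α β =
          (∑ i ∈ Finset.Icc 2 (k - 1), min (((d - i : ℕ) : ℝ≥0∞) * β) α) +
            2 * min ((d : ℝ≥0∞) * β) α := by
  obtain ⟨l, hl⟩ := hd_even
  have hm : n = 2 * (l + 1) := by omega
  have hk' : k = l + 1 + 1 := by omega
  have upper := fun (B : RegeneratingCode.DHS n d) (α β : ℝ≥0∞) =>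
    RegeneratingCode.schemeMinCut_le_bound hn hm (by omega) hk' B α β
  have lower := RegeneratingCode.bound_le_schemeMinCut_fhs hdn hn hm (by omega) hk' σ
  exact ⟨fun B α β => (upper B α β).trans (lower α β),
    fun α β => le_antisymm (upper _ α β) (lower α β)⟩
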